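/- For $\lambda\in[0,1]$ and $x,y>0$ let $$c_\lambda(x,y)=\frac{1+\lambda}{2}\left(\frac{1}{x+\lambda y}+\frac{1}{\lambda x+y}\right).$$ A Morozova–Chentsov function is a function of the form $c(x,y)=\dfrac{1}{y f(xy^{-1})}$, $x,y>0$, where $f$ is a positive operator monotone function on $(0,\infty)$ with $f(t)=tf(t^{-1})$ for $t>0$; it is normalized if $c(1,1)=1$. We say that $c$ is represented by $\mu_c$ if $\mu_c$ is the unique finite Borel measure on $[0,1]$ such that $$c(x,y)=\int_0^1 c_\lambda(x,y)\,d\mu_c(\lambda)\qquad\text{for all } x,y>0 .$$ Quotients below that are undefined at $x=y$ are extended there by continuity, that is, by $c(x,x)=1/x$. Then the following functions are normalized Morozova–Chentsov functions, and they are represented by the measures given. 1. (Wigner–Yanase–Dyson metric) For $0<p<1$, the function $$c(x,y)=\frac{1}{p(1-p)}\cdot\frac{(x^p-y^p)(x^{1-p}-y^{1-p})}{(x-y)^2}$$ is represented by $$d\mu_c(\lambda)=\frac{2\sin p\pi}{\pi p(1-p)}\cdot\frac{\lambda^p+\lambda^{1-p}}{(1+\lambda)^3}\,d\lambda .$$ The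 Wigner–Yanase metric, with $c(x,y)=4/(\sqrt x+\sqrt y)^2$, is obtained by setting $p=1/2$ and is represented by $$d\mu_c(\lambda)=\frac{16\lambda^{1/2}}{\pi(1+\lambda)^3}\,d\lambda .$$ 2. (Kubo metric) The function $$c(x,y)=\frac{\log x-\log y}{x-y}$$ is represented by $$d\mu_c(\lambda)=\frac{2}{(1+\lambda)^2}\,d\lambda .$$ 3. (Increasing bridge) For $0\le\gamma\le1$, the function $$c_\gamma(x,y)=x^{-\gamma}y^{-\gamma}\left(\frac{x+y}{2}\right)^{2\gamma-1}$$ is represented by the Dirac measure with unit mass at $1$ if $\gamma=0$, by $$d\mu_c(\lambda)=\frac{2\sin\gamma\pi}{(1+\lambda)\pi}\,\lambda^{-\gamma}\left(\frac{1-\lambda}{2}\right)^{2\gamma-1}d\lambda$$ if $0<\gamma<1$, and by the Dirac measure with unit mass at $0$ if $\gamma=1$. -/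

import Mathlib

open MeasureTheory Set
open scoped ComplexOrder

/-- A real function on the positive half-axis is operator monotone if `A ≤ B` implies
`f(A) ≤ f(B)` for all positive definite complex matrices `A`, `B` of any order, where `≤` is the
Loewner order and `f(A)` is given by the functional calculus. -/
def OperatorMonotoneOnPos (f : ℝ → ℝ) : Prop :=
  ∀ (n : ℕ) (A B : Matrix (Fin n) (Fin n) ℂ), A.PosDef → B.PosDef →
    (B - A).PosSemidef → (cfc f B - cfc f A).PosSemidef

/-- Morozova-Chentsov functions: `c(x, y) = 1 / (y f(x y⁻¹))` for `x, y > 0`, where `f` is a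
positive operator monotone function on the positive half-axis with `f(t) = t f(t⁻¹)`. Only the
values at `x, y > 0` matter. -/
def IsMorozovaChentsov (c : ℝ → ℝ → ℝ) : Prop :=
  ∃ f : ℝ → ℝ, (∀ t, 0 < t → 0 < f t) ∧ OperatorMonotoneOnPos f ∧
    (∀ t, 0 < t → f t = t * f t⁻¹) ∧
    ∀ x y, 0 < x → 0 < y → c x y = 1 / (y * f (x * y⁻¹))

/-- A Morozova-Chentsov function normalized by `c(1, 1) = 1`. -/
def IsNormalizedMorozovaChentsov (c : ℝ → ℝ → ℝ) : Prop :=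
  IsMorozovaChentsov c ∧ c 1 1 = 1

/-- The extreme Morozova-Chentsov functions `c_λ`, for `λ` in `[0, 1]`. -/
noncomputable def extremeMC (l x y : ℝ) : ℝ :=
  (1 + l) / 2 * (1 / (x + l * y) + 1 / (l * x + y))

/-- `μ` is a finite Borel measure on `[0, 1]` (a Borel measure on the line that vanishes outside
`[0, 1]`) with `c(x, y) = ∫ c_λ(x, y) dμ(λ)` for all `x, y > 0`. For such `μ` the integrand is
bounded on `[0, 1]`, hence integrable. -/
structure Represents (μ : Measure ℝ) (c : ℝ → ℝ → ℝ) : Prop where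
  finite : IsFiniteMeasure μ
  support : μ (Icc 0 1)ᶜ = 0
  eq_integral : ∀ x y, 0 < x → 0 < y → c x y = ∫ l, extremeMC l x y ∂μ

/-- `μ` is the measure `μ_c` in the canonical representation of `c`: it represents `c`, and it is
the only measure that does. -/
def IsRepresentingMeasure (μ : Measure ℝ) (c : ℝ → ℝ → ℝ) : Prop :=
  Represents μ c ∧ ∀ ν : Measure ℝ, Represents ν c → ν = μ

/-- The measure `φ(λ) dλ` on `[0, 1]`, for a nonnegative function `φ`. -/
noncomputable def densityMeasure (φ : ℝ → ℝ) : Measure ℝ :=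
  (volume.restrict (Icc 0 1)).withDensity fun l => ENNReal.ofReal (φ l)

/-- The Wigner-Yanase-Dyson function, extended to `x = y` by continuity. -/
noncomputable def wydMC (p x y : ℝ) : ℝ :=
  if x = y then 1 / x
  else 1 / (p * (1 - p)) * ((x ^ p - y ^ p) * (x ^ (1 - p) - y ^ (1 - p)) / (x - y) ^ 2)

/-- The Wigner-Yanase function. -/
noncomputable def wignerYanaseMC (x y : ℝ) : ℝ :=
  4 / (√x + √y) ^ 2

/-- The Kubo function, extended to `x = y` by continuity. -/
noncomputable def kuboMC (x y : ℝ) : ℝ :=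
  if x = y then 1 / x else (Real.log x - Real.log y) / (x - y)

/-- The functions `c_γ` of the increasing bridge. -/
noncomputable def bridgeMC (γ x y : ℝ) : ℝ :=
  x ^ (-γ) * y ^ (-γ) * ((x + y) / 2) ^ (2 * γ - 1)

/-!
The whole statement follows from the integral representations of the listed functions.

Existence of a representing measure makes `c` a Morozova-Chentsov function
(`Represents.isNormalizedMorozovaChentsov`). On positive definite matrices each `c_λ(·, 1)` is a
positive combination of functions `t ↦ (r t + s)⁻¹`, hence operator antitone. The functional
calculus commutes with the integral over `λ`, so `c(·, 1)` is operator antitone, and inverting once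
more, `f = 1 / c(·, 1)` is operator monotone. The symmetry of `f` and its relation to `c` come from
the symmetry and homogeneity of the `c_λ`.

A representing measure is unique (`Represents.unique`). With `s = λ / (1 + λ) ^ 2` and
`u = (1 - t) ^ 2 / t` one has `c_λ(t, 1) = (t + 1) / (2 t) * (1 + s u)⁻¹`. The integrals of
`(1 + s u)⁻¹` for all `u ≥ 0` determine the moments of `s`
(`integral_pow_eq_of_integral_inv_eq`), and since `s` is injective on `[0, 1]` these determine the
measure by the Stone-Weierstrass theorem (`ext_of_forall_integral_pow_eq`).

The representations themselves are computations. The Kubo function has an elementary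
antiderivative. The other two densities reduce to the Beta integrals
`∫ v ^ (a - 1) / (1 + v) ^ (a + b)` and `∫ v ^ (p - 1) / (v + t) = π / sin (π p) * t ^ (p - 1)` over
the positive half-axis: for the Wigner-Yanase-Dyson functions by folding at `λ = 1` and partial
fractions, for the increasing bridge by the substitution `v = (1 - λ) ^ 2 / (4 λ)`.
At its ends the bridge consists of the extreme functions `c_1` and `c_0` themselves.
-/

/-! ### The extreme functions -/

lemma extremeMC_mul_mul (l x y r : ℝ) :
    extremeMC l (r * x) (r * y) = r⁻¹ * extremeMC l x y := by
  have h1 : r * x + l * (r * y) = r * (x + l * y) := by ring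
  have h2 : l * (r * x) + r * y = r * (l * x + y) := by ring
  simp only [extremeMC, h1, h2, one_div, mul_inv]
  ring

lemma extremeMC_comm (l x y : ℝ) : extremeMC l x y = extremeMC l y x := by
  simp only [extremeMC]
  rw [add_comm (l * x) y, add_comm (l * y) x, add_comm (1 / (x + l * y))]

lemma extremeMC_one_one {l : ℝ} (hl : 0 ≤ l) : extremeMC l 1 1 = 1 := by
  simp only [extremeMC]
  field_simp
  ring

/-- The extreme function `c_l` depends on `l` only through `l / (1 + l) ^ 2`. -/
lemma extremeMC_eq_inv {l t : ℝ} (hl : 0 ≤ l) (ht : 0 < t) :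
    extremeMC l t 1 =
      (t + 1) / (2 * t) * (1 + l / (1 + l) ^ 2 * ((1 - t) ^ 2 / t))⁻¹ := by
  have h1 : 0 < t + l := by positivity
  have h2 : 0 < l * t + 1 := by positivity
  have h3 : 0 < t * (1 + l) ^ 2 + l * (1 - t) ^ 2 := by positivity
  have h4 : 1 + l / (1 + l) ^ 2 * ((1 - t) ^ 2 / t) =
      (t * (1 + l) ^ 2 + l * (1 - t) ^ 2) / (t * (1 + l) ^ 2) := by
    field_simp
  rw [h4, extremeMC, mul_one, inv_div]
  field_simp
  ring

lemma extremeMC_pos {l t : ℝ} (hl : 0 ≤ l) (ht : 0 < t) : 0 < extremeMC l t 1 := by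
  simp only [extremeMC]
  positivity

lemma continuousOn_extremeMC :
    ContinuousOn (Function.uncurry fun l t : ℝ => extremeMC l t 1) (Ici 0 ×ˢ Ioi 0) := by
  have h1 : ∀ z ∈ Ici (0 : ℝ) ×ˢ Ioi (0 : ℝ), z.2 + z.1 * 1 ≠ 0 := by
    rintro ⟨l, t⟩ ⟨hl, ht⟩
    simp only [mem_Ici, mem_Ioi] at hl ht ⊢
    positivity
  have h2 : ∀ z ∈ Ici (0 : ℝ) ×ˢ Ioi (0 : ℝ), z.1 * z.2 + 1 ≠ 0 := by
    rintro ⟨l, t⟩ ⟨hl, ht⟩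
    simp only [mem_Ici, mem_Ioi] at hl ht ⊢
    positivity
  simp only [Function.uncurry_def, extremeMC]
  fun_prop (disch := assumption)

/-! ### Operator monotonicity -/

section CStar

variable {A : Type*} [CStarAlgebra A] [PartialOrder A] [StarOrderedRing A]

/-- For `r, s ≥ 0` not both zero, `t ↦ (r t + s)⁻¹` is operator antitone on the positive
half-axis. -/
lemma cfc_inv_affine_le {a b : A} (ha : IsStrictlyPositive a) (hab : a ≤ b) {r s : ℝ}
    (hr : 0 ≤ r) (hs : 0 ≤ s) (hrs : 0 < r + s) :
    cfc (fun t : ℝ => (r * t + s)⁻¹) b ≤ cfc (fun t : ℝ => (r * t + s)⁻¹) a := by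
  have hb : IsStrictlyPositive b := ha.of_le hab
  have key : ∀ x : A, IsStrictlyPositive x →
      (∀ t ∈ spectrum ℝ x, 0 < r * t + s) ∧
      cfc (fun t : ℝ => r * t + s) x = r • x + algebraMap ℝ A s := by
    intro x hx
    refine ⟨fun t ht => ?_, ?_⟩
    · have h0 := hx.spectrum_pos ht
      rcases hr.eq_or_lt with rfl | hr
      · simpa using hrs
      · positivity
    · have hsa : IsSelfAdjoint x := hx.isSelfAdjoint
      rw [cfc_add_const .., cfc_const_mul_id ..]
  rw [cfc_inv _ b (fun t ht => ((key b hb).1 t ht).ne') (by fun_prop) hb.isSelfAdjoint,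
    cfc_inv _ a (fun t ht => ((key a ha).1 t ht).ne') (by fun_prop) ha.isSelfAdjoint]
  apply CStarAlgebra.ringInverse_le_ringInverse
  · rw [(key a ha).2, (key b hb).2]
    gcongr
  · rw [cfc_isStrictlyPositive_iff _ a (by fun_prop) ha.isSelfAdjoint]
    exact (key a ha).1

lemma cfc_extremeMC_le {a b : A} (ha : IsStrictlyPositive a) (hab : a ≤ b) {l : ℝ}
    (hl : 0 ≤ l) :
    cfc (fun t : ℝ => extremeMC l t 1) b ≤ cfc (fun t : ℝ => extremeMC l t 1) a := by
  have key : ∀ x : A, IsStrictlyPositive x → cfc (fun t : ℝ => extremeMC l t 1) x =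
      ((1 + l) / 2) • (cfc (fun t : ℝ => (1 * t + l)⁻¹) x +
        cfc (fun t : ℝ => (l * t + 1)⁻¹) x) := by
    intro x hx
    have hsa : IsSelfAdjoint x := hx.isSelfAdjoint
    have h1 : ContinuousOn (fun t : ℝ => (1 * t + l)⁻¹) (spectrum ℝ x) := by
      refine ContinuousOn.inv₀ (by fun_prop) fun t ht => ?_
      have := hx.spectrum_pos ht
      positivity
    have h2 : ContinuousOn (fun t : ℝ => (l * t + 1)⁻¹) (spectrum ℝ x) := by
      refine ContinuousOn.inv₀ (by fun_prop) fun t ht => ?_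
      have := hx.spectrum_pos ht
      positivity
    rw [← cfc_add x _ _ h1 h2, ← cfc_smul ((1 + l) / 2)
      (fun t : ℝ => (1 * t + l)⁻¹ + (l * t + 1)⁻¹) x (h1.add h2)]
    refine cfc_congr fun t _ => ?_
    simp [extremeMC]
  rw [key a ha, key b (ha.of_le hab)]
  have h1 := cfc_inv_affine_le ha hab zero_le_one hl (by positivity)
  have h2 := cfc_inv_affine_le ha hab hl zero_le_one (by positivity)
  gcongr

lemma cfc_integral_extremeMC {a : A} (ha : IsStrictlyPositive a) (μ : Measure ℝ)
    [IsFiniteMeasure μ] :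
    cfc (fun t : ℝ => ∫ l in Icc 0 1, extremeMC l t 1 ∂μ) a =
        ∫ l in Icc 0 1, cfc (fun t : ℝ => extremeMC l t 1) a ∂μ ∧
      IntegrableOn (fun l => cfc (fun t : ℝ => extremeMC l t 1) a) (Icc 0 1) μ := by
  have hcont : ContinuousOn (Function.uncurry fun l t : ℝ => extremeMC l t 1)
      (Icc 0 1 ×ˢ spectrum ℝ a) :=
    continuousOn_extremeMC.mono <|
      prod_mono (fun l hl => hl.1) fun t ht => ha.spectrum_pos ht
  obtain ⟨C, hC⟩ := (isCompact_Icc.prod (spectrum.isCompact a)).exists_bound_of_continuousOn hcont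
  have hbound : ∀ᵐ l ∂μ.restrict (Icc 0 1), ∀ t ∈ spectrum ℝ a, ‖extremeMC l t 1‖ ≤ C :=
    ae_restrict_of_forall_mem measurableSet_Icc fun l hl t ht => hC (l, t) ⟨hl, ht⟩
  exact ⟨cfc_setIntegral measurableSet_Icc _ (fun _ => C) a hcont hbound
      (hasFiniteIntegral_const C) ha.isSelfAdjoint,
    integrableOn_cfc measurableSet_Icc _ (fun _ => C) a hcont hbound
      (hasFiniteIntegral_const C) ha.isSelfAdjoint⟩

/-- If `g` is positive and an integral of extreme functions, then `1 / g` is operator monotone: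
`g` is operator antitone, and so is inversion. -/
lemma cfc_one_div_le_of_integral {g : ℝ → ℝ} {μ : Measure ℝ} [IsFiniteMeasure μ]
    (hpos : ∀ t, 0 < t → 0 < g t)
    (hg : ∀ t, 0 < t → g t = ∫ l in Icc 0 1, extremeMC l t 1 ∂μ)
    {a b : A} (hga : ContinuousOn g (spectrum ℝ a)) (hgb : ContinuousOn g (spectrum ℝ b))
    (ha : IsStrictlyPositive a) (hab : a ≤ b) :
    cfc (fun t => 1 / g t) a ≤ cfc (fun t => 1 / g t) b := by
  have hb : IsStrictlyPositive b := ha.of_le hab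
  have key : ∀ x : A, IsStrictlyPositive x → ContinuousOn g (spectrum ℝ x) →
      cfc (fun t => 1 / g t) x = Ring.inverse (cfc g x) ∧ IsStrictlyPositive (cfc g x) ∧
      cfc g x = ∫ l in Icc 0 1, cfc (fun t : ℝ => extremeMC l t 1) x ∂μ := by
    intro x hx hc
    simp only [one_div]
    refine ⟨cfc_inv g x (fun t ht => (hpos t (hx.spectrum_pos ht)).ne') hc hx.isSelfAdjoint, ?_, ?_⟩
    · rw [cfc_isStrictlyPositive_iff _ x hc hx.isSelfAdjoint]
      exact fun t ht => hpos t (hx.spectrum_pos ht)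
    · rw [← (cfc_integral_extremeMC hx μ).1]
      exact cfc_congr fun t ht => hg t (hx.spectrum_pos ht)
  rw [(key a ha hga).1, (key b hb hgb).1]
  refine CStarAlgebra.ringInverse_le_ringInverse ?_ (key b hb hgb).2.1
  rw [(key a ha hga).2.2, (key b hb hgb).2.2]
  refine integral_mono_ae (cfc_integral_extremeMC hb μ).2 (cfc_integral_extremeMC ha μ).2 ?_
  exact ae_restrict_of_forall_mem measurableSet_Icc fun l hl => cfc_extremeMC_le ha hab hl.1

end CStar

open scoped Matrix.Norms.L2Operator MatrixOrder in
lemma operatorMonotoneOnPos_one_div_of_integral {g : ℝ → ℝ} {μ : Measure ℝ} [IsFiniteMeasure μ]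
    (hpos : ∀ t, 0 < t → 0 < g t)
    (hg : ∀ t, 0 < t → g t = ∫ l in Icc 0 1, extremeMC l t 1 ∂μ) :
    OperatorMonotoneOnPos fun t => 1 / g t := by
  intro n A B hA _ hAB
  exact Matrix.le_iff.1 <| cfc_one_div_le_of_integral hpos hg
    (Matrix.finite_real_spectrum.continuousOn g) (Matrix.finite_real_spectrum.continuousOn g)
    hA.isStrictlyPositive (Matrix.le_iff.2 hAB)

lemma Represents.restrict_Icc {μ : Measure ℝ} {c : ℝ → ℝ → ℝ} (h : Represents μ c) :
    μ.restrict (Icc 0 1) = μ :=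
  Measure.restrict_eq_self_of_ae_mem (ae_iff.2 h.support)

/-- A function with an integral representation and `c 1 1 = 1` is a Morozova-Chentsov function, with
`f t = 1 / c t 1`. -/
lemma Represents.isNormalizedMorozovaChentsov {μ : Measure ℝ} {c : ℝ → ℝ → ℝ} (h : Represents μ c)
    (h1 : c 1 1 = 1) : IsNormalizedMorozovaChentsov c := by
  have := h.finite
  have hint : ∀ t, 0 < t → c t 1 = ∫ l in Icc 0 1, extremeMC l t 1 ∂μ := fun t ht => by
    rw [h.eq_integral t 1 ht one_pos, h.restrict_Icc]
  have hscale : ∀ x y r, 0 < x → 0 < y → 0 < r → c (r * x) (r * y) = r⁻¹ * c x y := by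
    intro x y r hx hy hr
    rw [h.eq_integral _ _ (mul_pos hr hx) (mul_pos hr hy), h.eq_integral x y hx hy,
      ← integral_const_mul]
    simp only [extremeMC_mul_mul]
  have hsymm : ∀ x y, 0 < x → 0 < y → c x y = c y x := by
    intro x y hx hy
    rw [h.eq_integral x y hx hy, h.eq_integral y x hy hx]
    simp only [extremeMC_comm _ x y]
  have hpos : ∀ t, 0 < t → 0 < c t 1 := by
    intro t ht
    rw [hint t ht, setIntegral_pos_iff_support_of_nonneg_ae]
    · have hsub : Icc 0 1 ⊆ (Function.support fun l => extremeMC l t 1) ∩ Icc 0 1 :=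
        fun l hl => ⟨(extremeMC_pos hl.1 ht).ne', hl⟩
      refine lt_of_lt_of_le (pos_iff_ne_zero.2 fun h0 => ?_) (measure_mono hsub)
      have := hint 1 one_pos
      rw [Measure.restrict_eq_zero.2 h0, integral_zero_measure, h1] at this
      exact one_ne_zero this
    · exact ae_restrict_of_forall_mem measurableSet_Icc fun l hl => (extremeMC_pos hl.1 ht).le
    · refine ContinuousOn.integrableOn_compact isCompact_Icc ?_
      exact continuousOn_extremeMC.comp (f := fun l => (l, t)) (by fun_prop)
        fun l hl => ⟨hl.1, ht⟩
  refine ⟨⟨fun t => 1 / c t 1, fun t ht => one_div_pos.2 (hpos t ht),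
    operatorMonotoneOnPos_one_div_of_integral hpos hint, fun t ht => ?_, fun x y hx hy => ?_⟩, h1⟩
  · have := hscale t 1 t⁻¹ ht one_pos (inv_pos.2 ht)
    rw [inv_mul_cancel₀ ht.ne', mul_one, inv_inv] at this
    simp only [hsymm _ _ (inv_pos.2 ht) one_pos, this]
    field_simp
  · have := hscale (x * y⁻¹) 1 y (by positivity) one_pos hy
    rw [mul_one, mul_comm x, mul_inv_cancel_left₀ hy.ne'] at this
    simp only [this, mul_comm x, one_div, mul_inv, inv_inv]

/-! ### Uniqueness of the representing measure -/

/-- Finite measures `μ`, `ν` for which all integrals `∫ (1 + u s)⁻¹`, `u ≥ 0`, agree have the same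
moments in `s`, for `s` with values in `[0, 1]`: subtracting the first terms of the geometric
series from `(1 + u s)⁻¹` and dividing by `(-u)ⁿ` leaves `sⁿ (1 + u s)⁻¹`, and this tends to `sⁿ`
as `u → 0`. -/
lemma integral_pow_eq_of_integral_inv_eq {E : Type*} [MeasurableSpace E] {μ ν : Measure E}
    [IsFiniteMeasure μ] [IsFiniteMeasure ν] {s : E → ℝ} (hs : Measurable s)
    (hs0 : ∀ x, 0 ≤ s x) (hs1 : ∀ x, s x ≤ 1)
    (h : ∀ u, 0 ≤ u → ∫ x, (1 + s x * u)⁻¹ ∂μ = ∫ x, (1 + s x * u)⁻¹ ∂ν) (n : ℕ) :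
    ∫ x, s x ^ n ∂μ = ∫ x, s x ^ n ∂ν := by
  have hpow : ∀ x n, s x ^ n ≤ 1 := fun x n => pow_le_one₀ (hs0 x) (hs1 x)
  have hden : ∀ x u, 0 ≤ u → 1 ≤ 1 + s x * u := fun x u hu =>
    le_add_of_nonneg_right (mul_nonneg (hs0 x) hu)
  have hle : ∀ x n u, 0 ≤ u → ‖s x ^ n * (1 + s x * u)⁻¹‖ ≤ 1 := by
    intro x n u hu
    have h0 := pow_nonneg (hs0 x) n
    have h1 := hden x u hu
    rw [Real.norm_of_nonneg (mul_nonneg h0 (inv_nonneg.2 (by linarith)))]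
    exact mul_le_one₀ (hpow x n) (inv_nonneg.2 (by linarith)) (inv_le_one_of_one_le₀ h1)
  have hint : ∀ (ρ : Measure E) [IsFiniteMeasure ρ] (n : ℕ) (u : ℝ), 0 ≤ u →
      Integrable (fun x => s x ^ n * (1 + s x * u)⁻¹) ρ := fun ρ _ n u hu =>
    Integrable.of_bound (by fun_prop) 1 (.of_forall fun x => hle x n u hu)
  have hlim : ∀ (ρ : Measure E) [IsFiniteMeasure ρ] (n : ℕ),
      Filter.Tendsto (fun u => ∫ x, s x ^ n * (1 + s x * u)⁻¹ ∂ρ) (nhdsWithin 0 (Ioi 0))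
        (nhds (∫ x, s x ^ n ∂ρ)) := by
    intro ρ _ n
    refine tendsto_integral_filter_of_dominated_convergence (fun _ => 1)
      (.of_forall fun u => by fun_prop) ?_ (integrable_const _) (.of_forall fun x => ?_)
    · filter_upwards [self_mem_nhdsWithin] with u hu
      exact .of_forall fun x => hle x n u (le_of_lt hu)
    · have : ContinuousAt (fun u => s x ^ n * (1 + s x * u)⁻¹) 0 := by
        refine ContinuousAt.mul (by fun_prop) (ContinuousAt.inv₀ (by fun_prop) (by simp))
      simpa using this.tendsto.mono_left nhdsWithin_le_nhds
  have key : ∀ n u, 0 < u →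
      ∫ x, s x ^ n * (1 + s x * u)⁻¹ ∂μ = ∫ x, s x ^ n * (1 + s x * u)⁻¹ ∂ν := by
    intro n
    induction n with
    | zero => simpa using fun u hu => h u (le_of_lt hu)
    | succ n ih =>
      intro u hu
      have hmom : ∫ x, s x ^ n ∂μ = ∫ x, s x ^ n ∂ν :=
        tendsto_nhds_unique (hlim μ n) ((hlim ν n).congr' <| by
          filter_upwards [self_mem_nhdsWithin] with v hv using (ih v hv).symm)
      have hsplit : ∀ (ρ : Measure E) [IsFiniteMeasure ρ],
          ∫ x, s x ^ (n + 1) * (1 + s x * u)⁻¹ ∂ρ =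
            u⁻¹ * (∫ x, s x ^ n ∂ρ - ∫ x, s x ^ n * (1 + s x * u)⁻¹ ∂ρ) := by
        intro ρ _
        rw [← integral_sub (by simpa using hint ρ n 0 le_rfl) (hint ρ n u hu.le),
          ← integral_const_mul]
        congr 1 with x
        have := hden x u hu.le
        have : 1 + s x * u ≠ 0 := by linarith
        field_simp
        ring
      rw [hsplit, hsplit, hmom, ih u hu]
  exact tendsto_nhds_unique (hlim μ n) ((hlim ν n).congr' <| by
    filter_upwards [self_mem_nhdsWithin] with v hv using (key n v hv).symm)

/-- By the Stone-Weierstrass theorem, a finite measure on a Polish space is determined by the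
moments of a bounded continuous injective function. -/
lemma ext_of_forall_integral_pow_eq {E : Type*} [TopologicalSpace E] [PolishSpace E]
    [MeasurableSpace E] [BorelSpace E] {μ ν : Measure E} [IsFiniteMeasure μ] [IsFiniteMeasure ν]
    (s : BoundedContinuousFunction E ℝ) (hs : Function.Injective s)
    (h : ∀ n : ℕ, ∫ x, s x ^ n ∂μ = ∫ x, s x ^ n ∂ν) : μ = ν := by
  refine ext_of_forall_mem_subalgebra_integral_eq_of_polish (𝕜 := ℝ)
    (A := StarAlgebra.adjoin ℝ {s}) ?_ ?_
  · intro x y hxy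
    exact ⟨s, ⟨_, ⟨s, StarAlgebra.subset_adjoin ℝ {s} rfl, rfl⟩, rfl⟩, hs.ne hxy⟩
  · intro g hg
    rw [← StarSubalgebra.mem_toSubalgebra, StarAlgebra.adjoin_toSubalgebra, Set.star_singleton,
      show star s = s from rfl, union_self, Algebra.adjoin_singleton_eq_range_aeval] at hg
    obtain ⟨p, rfl⟩ := hg
    have hp : ⇑((Polynomial.aeval s).toRingHom p) =
        fun x => ∑ n ∈ Finset.range (p.natDegree + 1), p.coeff n * s x ^ n := by
      funext x
      simp [Polynomial.aeval_eq_sum_range]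
    have hint : ∀ (ρ : Measure E) [IsFiniteMeasure ρ] (n : ℕ),
        Integrable (fun x => p.coeff n * s x ^ n) ρ := fun ρ _ n =>
      ((s ^ n).integrable ρ).const_mul _
    rw [hp, integral_finsetSum _ fun n _ => hint μ n, integral_finsetSum _ fun n _ => hint ν n]
    simp only [integral_const_mul, h]

lemma injOn_div_one_add_sq : InjOn (fun l : ℝ => l / (1 + l) ^ 2) (Icc 0 1) := by
  rintro a ⟨ha0, ha1⟩ b ⟨hb0, hb1⟩ hab
  have ha : 0 < 1 + a := by linarith
  have hb : 0 < 1 + b := by linarith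
  simp only at hab
  rw [div_eq_div_iff (by positivity) (by positivity)] at hab
  have h : (a - b) * (1 - a * b) = 0 := by linear_combination hab
  rcases mul_eq_zero.1 h with h | h
  · linarith
  · nlinarith

/-- By `extremeMC_eq_inv`, the values `c t 1` are the integrals of `(1 + u s)⁻¹` up to factors, where
`s = l / (1 + l) ^ 2` is injective on `[0, 1]` and `u = (1 - t) ^ 2 / t` takes all values `≥ 0`. -/
lemma Represents.unique {μ ν : Measure ℝ} {c : ℝ → ℝ → ℝ} (hμ : Represents μ c)
    (hν : Represents ν c) : ν = μ := by
  have := hμ.finite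
  have := hν.finite
  let s : BoundedContinuousFunction (Icc (0 : ℝ) 1) ℝ :=
    BoundedContinuousFunction.mkOfCompact ⟨fun l => l.1 / (1 + l.1) ^ 2, by
      refine Continuous.div (by fun_prop) (by fun_prop) fun l => ?_
      have := l.2.1
      positivity⟩
  have hsval : ∀ l, s l = l.1 / (1 + l.1) ^ 2 := fun l => rfl
  have hinj : Function.Injective s := fun a b hab =>
    Subtype.ext (injOn_div_one_add_sq a.2 b.2 hab)
  have hcomap : ∀ (ρ : Measure ℝ), Represents ρ c → ∀ t, 0 < t →
      ∫ l : Icc (0 : ℝ) 1, (1 + s l * ((1 - t) ^ 2 / t))⁻¹ ∂ρ.comap Subtype.val =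
        2 * t / (t + 1) * c t 1 := by
    intro ρ hρ t ht
    simp only [hsval]
    rw [integral_subtype_comap measurableSet_Icc
      (fun l : ℝ => (1 + l / (1 + l) ^ 2 * ((1 - t) ^ 2 / t))⁻¹), hρ.eq_integral t 1 ht one_pos,
      ← hρ.restrict_Icc, Measure.restrict_restrict measurableSet_Icc, inter_self,
      ← integral_const_mul]
    refine setIntegral_congr_fun measurableSet_Icc fun l hl => ?_
    simp only [extremeMC_eq_inv hl.1 ht]
    field_simp
  have hfin : ∀ (ρ : Measure ℝ) [IsFiniteMeasure ρ],
      IsFiniteMeasure (ρ.comap (Subtype.val : Icc (0 : ℝ) 1 → ℝ)) := by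
    intro ρ _
    refine ⟨?_⟩
    rw [comap_subtype_coe_apply measurableSet_Icc]
    exact measure_lt_top _ _
  have := hfin μ
  have := hfin ν
  have heq : ν.comap (Subtype.val : Icc (0 : ℝ) 1 → ℝ) = μ.comap Subtype.val := by
    refine ext_of_forall_integral_pow_eq s hinj fun n => ?_
    refine integral_pow_eq_of_integral_inv_eq s.continuous.measurable (fun l => ?_) (fun l => ?_)
      (fun u hu => ?_) n
    · have := l.2.1
      rw [hsval]
      positivity
    · have h0 := l.2.1
      rw [hsval, div_le_one (by positivity)]
      nlinarith
    · -- The larger root `t` of `(1 - t) ^ 2 = u t`.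
      obtain ⟨t, ht, hut⟩ : ∃ t : ℝ, 0 < t ∧ (1 - t) ^ 2 / t = u := by
        have hsq : √(u ^ 2 + 4 * u) ^ 2 = u ^ 2 + 4 * u := Real.sq_sqrt (by positivity)
        have h0 := Real.sqrt_nonneg (u ^ 2 + 4 * u)
        have ht : 0 < (2 + u + √(u ^ 2 + 4 * u)) / 2 := by positivity
        refine ⟨(2 + u + √(u ^ 2 + 4 * u)) / 2, ht, ?_⟩
        rw [div_eq_iff ht.ne']
        linear_combination hsq / 4
      rw [← hut, hcomap μ hμ t ht, hcomap ν hν t ht]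
  rw [← hν.restrict_Icc, ← hμ.restrict_Icc, ← map_comap_subtype_coe measurableSet_Icc ν,
    ← map_comap_subtype_coe measurableSet_Icc μ, heq]

lemma Represents.isRepresentingMeasure {μ : Measure ℝ} {c : ℝ → ℝ → ℝ} (h : Represents μ c) :
    IsRepresentingMeasure μ c :=
  ⟨h, fun _ hν => h.unique hν⟩

/-! ### Beta integrals on the half-line -/

lemma integral_rpow_mul_one_sub_rpow {a b : ℝ} (ha : 0 < a) (hb : 0 < b) :
    IntegrableOn (fun x : ℝ => x ^ (a - 1) * (1 - x) ^ (b - 1)) (Ioo 0 1) ∧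
      ∫ x in Ioo (0 : ℝ) 1, x ^ (a - 1) * (1 - x) ^ (b - 1) =
        Real.Gamma a * Real.Gamma b / Real.Gamma (a + b) := by
  have hre : EqOn (fun x : ℝ => ((x : ℂ) ^ ((a : ℂ) - 1) * (1 - (x : ℂ)) ^ ((b : ℂ) - 1)).re)
      (fun x : ℝ => x ^ (a - 1) * (1 - x) ^ (b - 1)) (Ioo 0 1) := by
    rintro x ⟨hx0, hx1⟩
    dsimp only
    rw [← Complex.ofReal_one, ← Complex.ofReal_sub, ← Complex.ofReal_sub, ← Complex.ofReal_sub,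
      ← Complex.ofReal_cpow hx0.le, ← Complex.ofReal_cpow (by linarith), ← Complex.ofReal_mul,
      Complex.ofReal_re]
  have hint := Complex.betaIntegral_convergent (u := a) (v := b) (by simpa) (by simpa)
  rw [intervalIntegrable_iff_integrableOn_Ioo_of_le zero_le_one] at hint
  refine ⟨(integrableOn_congr_fun hre measurableSet_Ioo).1 hint.re, ?_⟩
  rw [← setIntegral_congr_fun measurableSet_Ioo hre]
  have h := ProbabilityTheory.beta_eq_betaIntegralReal a b ha hb
  rw [ProbabilityTheory.beta, Complex.betaIntegral, intervalIntegral.integral_of_le zero_le_one,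
    integral_Ioc_eq_integral_Ioo] at h
  rw [h]
  exact integral_re hint

lemma image_div_one_add_Ioi : (fun v : ℝ => v / (1 + v)) '' Ioi 0 = Ioo 0 1 := by
  ext x
  constructor
  · rintro ⟨v, hv, rfl⟩
    have hv : 0 < v := hv
    exact ⟨by positivity, by rw [div_lt_one (by positivity)]; linarith⟩
  · rintro ⟨hx0, hx1⟩
    have : 0 < 1 - x := by linarith
    refine ⟨x / (1 - x), div_pos hx0 this, ?_⟩
    field_simp
    ring

lemma integral_rpow_div_one_add_rpow {a b : ℝ} (ha : 0 < a) (hb : 0 < b) :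
    IntegrableOn (fun v : ℝ => v ^ (a - 1) / (1 + v) ^ (a + b)) (Ioi 0) ∧
      ∫ v in Ioi (0 : ℝ), v ^ (a - 1) / (1 + v) ^ (a + b) =
        Real.Gamma a * Real.Gamma b / Real.Gamma (a + b) := by
  have hderiv : ∀ v ∈ Ioi (0 : ℝ),
      HasDerivWithinAt (fun v : ℝ => v / (1 + v)) (1 / (1 + v) ^ 2) (Ioi 0) v := by
    intro v hv
    have hv : 0 < v := hv
    have h := (hasDerivAt_id v).div ((hasDerivAt_id v).const_add 1) (by simp; positivity)
    refine (h.congr_deriv ?_).hasDerivWithinAt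
    simp
  have hinj : InjOn (fun v : ℝ => v / (1 + v)) (Ioi 0) := by
    intro v hv w hw h
    have hv : 0 < v := hv
    have hw : 0 < w := hw
    simp only at h
    rw [div_eq_div_iff (by positivity) (by positivity)] at h
    linarith
  have heq : EqOn (fun v : ℝ => |1 / (1 + v) ^ 2| •
        ((v / (1 + v)) ^ (a - 1) * (1 - v / (1 + v)) ^ (b - 1)))
      (fun v : ℝ => v ^ (a - 1) / (1 + v) ^ (a + b)) (Ioi 0) := by
    intro v hv
    have hv : 0 < v := hv
    have h1 : 0 < 1 + v := by positivity
    have h2 : 1 - v / (1 + v) = (1 + v)⁻¹ := by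
      field_simp
      ring
    have h3 : (1 + v) ^ (a + b) = (1 + v) ^ (a - 1) * (1 + v) ^ (b - 1) * (1 + v) ^ 2 := by
      rw [← Real.rpow_add h1, ← Real.rpow_two, ← Real.rpow_add h1]
      ring_nf
    simp only [smul_eq_mul]
    rw [h2, h3, Real.div_rpow hv.le h1.le, Real.inv_rpow h1.le, abs_of_pos (by positivity)]
    field_simp
  obtain ⟨hi, hv⟩ := integral_rpow_mul_one_sub_rpow ha hb
  rw [← image_div_one_add_Ioi] at hi hv
  constructor
  · rw [integrableOn_image_iff_integrableOn_abs_deriv_smul measurableSet_Ioi hderiv hinj] at hi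
    exact (integrableOn_congr_fun heq measurableSet_Ioi).1 hi
  · rw [integral_image_eq_integral_abs_deriv_smul measurableSet_Ioi hderiv hinj,
      setIntegral_congr_fun measurableSet_Ioi heq] at hv
    exact hv

lemma integral_rpow_div_add {p t : ℝ} (hp0 : 0 < p) (hp1 : p < 1) (ht : 0 < t) :
    IntegrableOn (fun v : ℝ => v ^ (p - 1) / (v + t)) (Ioi 0) ∧
      ∫ v in Ioi (0 : ℝ), v ^ (p - 1) / (v + t) =
        Real.pi / Real.sin (Real.pi * p) * t ^ (p - 1) := by
  obtain ⟨hi, hv⟩ := integral_rpow_div_one_add_rpow hp0 (sub_pos.2 hp1)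
  simp only [add_sub_cancel, Real.rpow_one, Real.Gamma_one, div_one,
    Real.Gamma_mul_Gamma_one_sub] at hi hv
  have heq : EqOn (fun v : ℝ => t ^ (p - 1) * (t⁻¹ * ((t⁻¹ * v) ^ (p - 1) / (1 + t⁻¹ * v))))
      (fun v => v ^ (p - 1) / (v + t)) (Ioi 0) := by
    intro v hv
    have hv : 0 < v := hv
    simp only
    rw [Real.mul_rpow (by positivity) hv.le, Real.inv_rpow ht.le]
    have : 0 < t ^ (p - 1) := by positivity
    field_simp
    ring
  constructor
  · refine (integrableOn_congr_fun heq measurableSet_Ioi).1 ?_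
    refine Integrable.const_mul (Integrable.const_mul ?_ _) _
    have := integrableOn_Ioi_comp_mul_left_iff (fun v : ℝ => v ^ (p - 1) / (1 + v)) 0
      (inv_pos.2 ht)
    rw [mul_zero] at this
    exact this.2 hi
  · rw [← setIntegral_congr_fun measurableSet_Ioi heq, integral_const_mul, integral_const_mul,
      integral_comp_mul_left_Ioi (fun v : ℝ => v ^ (p - 1) / (1 + v)) 0 (inv_pos.2 ht), mul_zero,
      hv, inv_inv, smul_eq_mul]
    field_simp

/-! ### Measures with a density -/

/-- By homogeneity, a representation has to be checked for the pairs `(t, 1)` only. The end points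
of `[0, 1]`, where densities may take junk values, do not matter. -/
lemma represents_densityMeasure {φ : ℝ → ℝ} {c : ℝ → ℝ → ℝ} (hφ : Measurable φ)
    (hφ0 : ∀ l ∈ Ioo (0 : ℝ) 1, 0 ≤ φ l)
    (hc : ∀ x y, 0 < x → 0 < y → c x y = y⁻¹ * c (x / y) 1)
    (hint : ∀ t, 0 < t → IntegrableOn (fun l => φ l * extremeMC l t 1) (Ioo 0 1) ∧
      ∫ l in Ioo 0 1, φ l * extremeMC l t 1 = c t 1) :
    Represents (densityMeasure φ) c := by
  have hfin : IntegrableOn φ (Ioo 0 1) := by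
    refine (integrableOn_congr_fun (fun l hl => ?_) measurableSet_Ioo).1 (hint 1 one_pos).1
    simp only [extremeMC_one_one hl.1.le, mul_one]
  have hdens : densityMeasure φ =
      (volume.restrict (Ioo 0 1)).withDensity fun l => ENNReal.ofReal (φ l) := by
    rw [densityMeasure, restrict_Ioo_eq_restrict_Icc]
  refine ⟨?_, ?_, fun x y hx hy => ?_⟩
  · rw [hdens]
    exact isFiniteMeasure_withDensity_ofReal hfin.2
  · exact withDensity_absolutelyContinuous _ _ (by
      rw [Measure.restrict_apply measurableSet_Icc.compl, compl_inter_self, measure_empty])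
  · rw [hc x y hx hy, ← (hint _ (div_pos hx hy)).2, hdens,
      integral_withDensity_eq_integral_toReal_smul hφ.ennreal_ofReal
        (.of_forall fun _ => ENNReal.ofReal_lt_top), ← integral_const_mul]
    refine setIntegral_congr_fun measurableSet_Ioo fun l hl => ?_
    have h := extremeMC_mul_mul l (x / y) 1 y
    rw [mul_one, mul_div_cancel₀ _ hy.ne'] at h
    simp only [h, ENNReal.toReal_ofReal (hφ0 l hl), smul_eq_mul]
    ring

/-! ### The Kubo metric -/

lemma represents_kuboMC : Represents (densityMeasure fun l => 2 / (1 + l) ^ 2) kuboMC := by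
  refine represents_densityMeasure (by fun_prop) (fun l hl => ?_) (fun x y hx hy => ?_)
    fun t ht => ?_
  · have := hl.1
    positivity
  · by_cases hxy : x = y
    · subst hxy
      simp [kuboMC, hx.ne']
    · have hne : x / y ≠ 1 := fun h => hxy ((div_eq_one_iff_eq hy.ne').1 h)
      have h1 : x - y ≠ 0 := sub_ne_zero.2 hxy
      rw [kuboMC, kuboMC, if_neg hxy, if_neg hne, Real.log_div hx.ne' hy.ne', Real.log_one,
        sub_zero]
      have h2 : x / y - 1 = (x - y) / y := by field_simp
      rw [h2]
      field_simp
  · have hcont : ContinuousOn (fun l : ℝ => 2 / (1 + l) ^ 2 * extremeMC l t 1) (Icc 0 1) := by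
      refine ContinuousOn.mul (ContinuousOn.div (by fun_prop) (by fun_prop) fun l hl => ?_) ?_
      · have := hl.1
        positivity
      · exact continuousOn_extremeMC.comp (f := fun l => (l, t)) (by fun_prop)
          fun l hl => ⟨hl.1, ht⟩
    refine ⟨(hcont.integrableOn_compact isCompact_Icc).mono_set Ioo_subset_Icc_self, ?_⟩
    rw [← integral_Ioc_eq_integral_Ioo, ← intervalIntegral.integral_of_le zero_le_one]
    have hii : IntervalIntegrable (fun l : ℝ => 2 / (1 + l) ^ 2 * extremeMC l t 1) volume 0 1 :=
      ContinuousOn.intervalIntegrable (by rwa [uIcc_of_le zero_le_one])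
    by_cases h1 : t = 1
    · subst h1
      rw [intervalIntegral.integral_eq_sub_of_hasDerivAt (f := fun l => -2 / (1 + l)) _ hii]
      · norm_num [kuboMC]
      · intro l hl
        rw [uIcc_of_le zero_le_one] at hl
        have hl0 : 1 + l ≠ 0 := by linarith [hl.1]
        rw [extremeMC_one_one hl.1]
        refine ((hasDerivAt_const l (-2 : ℝ)).div ((hasDerivAt_id l).const_add 1)
          hl0).congr_deriv ?_
        simp
    · have h2 : t - 1 ≠ 0 := sub_ne_zero.2 h1
      rw [intervalIntegral.integral_eq_sub_of_hasDerivAt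
        (f := fun l => (Real.log (l * t + 1) - Real.log (l + t)) / (t - 1)) _ hii]
      · simp only [kuboMC, if_neg h1]
        rw [one_mul, add_comm t 1, sub_self]
        simp
        ring
      · intro l hl
        rw [uIcc_of_le zero_le_one] at hl
        have hl0 : 0 ≤ l := hl.1
        have h3 : 0 < l * t + 1 := by positivity
        have h4 : 0 < l + t := by positivity
        refine (((((hasDerivAt_id l).mul_const t).add_const 1).log h3.ne').sub
          (((hasDerivAt_id l).add_const t).log h4.ne') |>.div_const (t - 1)).congr_deriv ?_
        simp only [extremeMC, id, mul_one, one_mul]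
        rw [add_comm t l]
        field_simp
        ring

/-! ### The Wigner-Yanase-Dyson metrics -/

/-- Folding an integral over the positive half-axis onto `(0, 1)` by `l ↦ l⁻¹`. -/
lemma integral_Ioi_eq_integral_Ioo_add_inv {h : ℝ → ℝ} (hi : IntegrableOn h (Ioi 0)) :
    IntegrableOn (fun l => h l + (l ^ 2)⁻¹ * h l⁻¹) (Ioo 0 1) ∧
      ∫ l in Ioo (0 : ℝ) 1, (h l + (l ^ 2)⁻¹ * h l⁻¹) = ∫ l in Ioi 0, h l := by
  have himage : (fun l : ℝ => l⁻¹) '' Ioo 0 1 = Ioi 1 := by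
    rw [image_inv_eq_inv, inv_Ioo_0_left one_pos, inv_one]
  have hderiv : ∀ l ∈ Ioo (0 : ℝ) 1,
      HasDerivWithinAt (fun l : ℝ => l⁻¹) (-(l ^ 2)⁻¹) (Ioo 0 1) l := fun l hl =>
    (hasDerivAt_inv hl.1.ne').hasDerivWithinAt
  have heq : EqOn (fun l : ℝ => |-(l ^ 2)⁻¹| • h l⁻¹) (fun l => (l ^ 2)⁻¹ * h l⁻¹) (Ioo 0 1) := by
    intro l hl
    simp only [smul_eq_mul]
    rw [abs_neg, abs_of_nonneg (by positivity)]
  have hi1 : IntegrableOn h (Ioo 0 1) := hi.mono_set Ioo_subset_Ioi_self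
  have hi2 : IntegrableOn h (Ioi 1) := hi.mono_set (Ioi_subset_Ioi zero_le_one)
  have hi3 : IntegrableOn (fun l => (l ^ 2)⁻¹ * h l⁻¹) (Ioo 0 1) := by
    rw [← himage, integrableOn_image_iff_integrableOn_abs_deriv_smul measurableSet_Ioo hderiv
      inv_injective.injOn] at hi2
    exact (integrableOn_congr_fun heq measurableSet_Ioo).1 hi2
  refine ⟨hi1.add hi3, ?_⟩
  rw [integral_add hi1 hi3, ← setIntegral_congr_fun measurableSet_Ioo heq,
    ← integral_image_eq_integral_abs_deriv_smul measurableSet_Ioo hderiv inv_injective.injOn,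
    himage, ← Ioc_union_Ioi_eq_Ioi (zero_le_one (α := ℝ)),
    setIntegral_union (Ioc_disjoint_Ioi le_rfl) measurableSet_Ioi
      (hi.mono_set Ioc_subset_Ioi_self) (hi.mono_set (Ioi_subset_Ioi zero_le_one)),
    integral_Ioc_eq_integral_Ioo]

lemma integral_rpow_div_one_add_sq_mul_add {q t : ℝ} (hq0 : 0 < q) (hq1 : q < 1) (ht : 0 < t)
    (ht1 : t ≠ 1) :
    IntegrableOn (fun v : ℝ => v ^ q / ((1 + v) ^ 2 * (v + t))) (Ioi 0) ∧
      ∫ v in Ioi (0 : ℝ), v ^ q / ((1 + v) ^ 2 * (v + t)) =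
        Real.pi / Real.sin (Real.pi * q) *
          ((t - t ^ q) / (t - 1) ^ 2 - (1 - q) / (t - 1)) := by
  obtain ⟨hi1, hv1⟩ := integral_rpow_div_add hq0 hq1 ht
  obtain ⟨hi2, hv2⟩ := integral_rpow_div_add hq0 hq1 one_pos
  obtain ⟨hi3, hv3⟩ := integral_rpow_div_one_add_rpow hq0 (show 0 < 2 - q by linarith)
  have hG : Real.Gamma (2 - q) = (1 - q) * Real.Gamma (1 - q) := by
    rw [← Real.Gamma_add_one (by linarith)]
    ring_nf
  rw [add_sub_cancel, hG, Real.Gamma_two, div_one, mul_left_comm,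
    Real.Gamma_mul_Gamma_one_sub] at hv3
  rw [add_sub_cancel] at hi3
  have h1 : t - 1 ≠ 0 := sub_ne_zero.2 ht1
  -- The partial fraction decomposition of `v / ((1 + v) ^ 2 * (v + t))`.
  have heq : EqOn (fun v : ℝ => -(t / (t - 1) ^ 2) * (v ^ (q - 1) / (v + t)) +
        t / (t - 1) ^ 2 * (v ^ (q - 1) / (v + 1)) - (t - 1)⁻¹ * (v ^ (q - 1) / (1 + v) ^ (2 : ℝ)))
      (fun v => v ^ q / ((1 + v) ^ 2 * (v + t))) (Ioi 0) := by
    intro v hv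
    have hv : 0 < v := hv
    have h2 : v ^ q = v * v ^ (q - 1) := by
      rw [← Real.rpow_one_add' hv.le (by linarith)]
      ring_nf
    simp only [Real.rpow_two, h2]
    field_simp
    ring
  have hj1 := Integrable.const_mul hi1 (-(t / (t - 1) ^ 2))
  have hj2 := Integrable.const_mul hi2 (t / (t - 1) ^ 2)
  have hj3 := Integrable.const_mul hi3 (t - 1)⁻¹
  have hj12 : Integrable (fun v : ℝ => -(t / (t - 1) ^ 2) * (v ^ (q - 1) / (v + t)) +
      t / (t - 1) ^ 2 * (v ^ (q - 1) / (v + 1))) (volume.restrict (Ioi 0)) := hj1.add hj2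
  refine ⟨(integrableOn_congr_fun heq measurableSet_Ioi).1 (hj12.sub hj3), ?_⟩
  rw [← setIntegral_congr_fun measurableSet_Ioi heq, integral_sub hj12 hj3,
    integral_add hj1 hj2, integral_const_mul, integral_const_mul, integral_const_mul, hv1, hv2, hv3]
  have h3 : t ^ q = t * t ^ (q - 1) := by
    rw [← Real.rpow_one_add' ht.le (by linarith)]
    ring_nf
  rw [h3, Real.one_rpow]
  field_simp
  ring

lemma integral_rpow_div_one_add_cube {q : ℝ} (hq0 : 0 < q) (hq1 : q < 1) :
    IntegrableOn (fun v : ℝ => v ^ q / ((1 + v) ^ 2 * (v + 1))) (Ioi 0) ∧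
      ∫ v in Ioi (0 : ℝ), v ^ q / ((1 + v) ^ 2 * (v + 1)) =
        Real.pi / Real.sin (Real.pi * q) * (q * (1 - q) / 2) := by
  obtain ⟨hi, hv⟩ := integral_rpow_div_one_add_rpow (show 0 < q + 1 by linarith)
    (show 0 < 2 - q by linarith)
  have hG : Real.Gamma (2 - q) = (1 - q) * Real.Gamma (1 - q) := by
    rw [← Real.Gamma_add_one (by linarith)]
    ring_nf
  have hG3 : Real.Gamma 3 = 2 := by
    rw [show (3 : ℝ) = 1 + 1 + 1 by norm_num, Real.Gamma_add_one (by norm_num),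
      Real.Gamma_add_one one_ne_zero, Real.Gamma_one]
    norm_num
  have heq : EqOn (fun v : ℝ => v ^ (q + 1 - 1) / (1 + v) ^ (q + 1 + (2 - q)))
      (fun v => v ^ q / ((1 + v) ^ 2 * (v + 1))) (Ioi 0) := by
    intro v hv
    have h3 : q + 1 + (2 - q) = ((3 : ℕ) : ℝ) := by
      push_cast
      ring
    simp only
    rw [h3, Real.rpow_natCast, add_sub_cancel_right]
    congr 1
    ring
  refine ⟨(integrableOn_congr_fun heq measurableSet_Ioi).1 hi, ?_⟩
  rw [← setIntegral_congr_fun measurableSet_Ioi heq, hv, ← Real.Gamma_mul_Gamma_one_sub, hG,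
    Real.Gamma_add_one hq0.ne', show q + 1 + (2 - q) = 3 by ring, hG3]
  ring

lemma wydMC_eq_inv_mul (p : ℝ) {x y : ℝ} (hx : 0 < x) (hy : 0 < y) :
    wydMC p x y = y⁻¹ * wydMC p (x / y) 1 := by
  by_cases hxy : x = y
  · subst hxy
    simp [wydMC, hx.ne']
  · have hne : x / y ≠ 1 := fun h => hxy ((div_eq_one_iff_eq hy.ne').1 h)
    have h1 : x - y ≠ 0 := sub_ne_zero.2 hxy
    have h2 : x / y - 1 = (x - y) / y := by field_simp
    have h3 : ∀ q : ℝ, (x / y) ^ q - 1 = (x ^ q - y ^ q) / y ^ q := by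
      intro q
      have : 0 < y ^ q := by positivity
      rw [Real.div_rpow hx.le hy.le]
      field_simp
    have h4 : y ^ (1 - p) = y / y ^ p := by rw [Real.rpow_sub hy, Real.rpow_one]
    have h5 : 0 < y ^ p := by positivity
    rw [wydMC, wydMC, if_neg hxy, if_neg hne, Real.one_rpow, Real.one_rpow, h3, h3, h2, h4]
    field_simp

/-- The two summands of `extremeMC l t 1` are exchanged, up to the Jacobian, by `l ↦ l⁻¹`, so the
representation amounts to the integral of `(l ^ p + l ^ (1 - p)) / ((1 + l) ^ 2 * (l + t))` over the
positive half-axis. -/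
lemma represents_wydMC {p : ℝ} (hp0 : 0 < p) (hp1 : p < 1) :
    Represents (densityMeasure fun l =>
      2 * Real.sin (p * Real.pi) / (Real.pi * p * (1 - p)) *
        ((l ^ p + l ^ (1 - p)) / (1 + l) ^ 3)) (wydMC p) := by
  have hp2 : 0 < 1 - p := sub_pos.2 hp1
  have hsin : 0 < Real.sin (Real.pi * p) :=
    Real.sin_pos_of_pos_of_lt_pi (by positivity) (by nlinarith [Real.pi_pos])
  have hsin' : Real.sin (Real.pi * (1 - p)) = Real.sin (Real.pi * p) := by
    rw [← Real.sin_pi_sub]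
    ring_nf
  rw [mul_comm p]
  refine represents_densityMeasure (by fun_prop) (fun l hl => ?_)
    (fun x y hx hy => wydMC_eq_inv_mul p hx hy) fun t ht => ?_
  · have := hl.1
    positivity
  · obtain ⟨hi, hv⟩ : IntegrableOn (fun v : ℝ => v ^ p / ((1 + v) ^ 2 * (v + t)) +
          v ^ (1 - p) / ((1 + v) ^ 2 * (v + t))) (Ioi 0) ∧
        ∫ v in Ioi (0 : ℝ), (v ^ p / ((1 + v) ^ 2 * (v + t)) +
          v ^ (1 - p) / ((1 + v) ^ 2 * (v + t))) =
        Real.pi / Real.sin (Real.pi * p) * (p * (1 - p) * wydMC p t 1) := by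
      by_cases ht1 : t = 1
      · subst ht1
        obtain ⟨hi1, hv1⟩ := integral_rpow_div_one_add_cube hp0 hp1
        obtain ⟨hi2, hv2⟩ := integral_rpow_div_one_add_cube hp2 (by linarith : 1 - p < 1)
        refine ⟨hi1.add hi2, ?_⟩
        rw [integral_add hi1 hi2, hv1, hv2, hsin', wydMC, if_pos rfl]
        ring
      · obtain ⟨hi1, hv1⟩ := integral_rpow_div_one_add_sq_mul_add hp0 hp1 ht ht1
        obtain ⟨hi2, hv2⟩ :=
          integral_rpow_div_one_add_sq_mul_add hp2 (by linarith : 1 - p < 1) ht ht1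
        refine ⟨hi1.add hi2, ?_⟩
        have h1 : t - 1 ≠ 0 := sub_ne_zero.2 ht1
        have h2 : t ^ (1 - p) = t / t ^ p := by rw [Real.rpow_sub ht, Real.rpow_one]
        have h3 : 0 < t ^ p := by positivity
        rw [integral_add hi1 hi2, hv1, hv2, hsin', wydMC, if_neg ht1, Real.one_rpow,
          Real.one_rpow, h2]
        field_simp
        ring
    obtain ⟨hj, hw⟩ := integral_Ioi_eq_integral_Ioo_add_inv hi
    have heq : EqOn (fun l : ℝ => Real.sin (Real.pi * p) / (Real.pi * p * (1 - p)) *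
          ((l ^ p / ((1 + l) ^ 2 * (l + t)) + l ^ (1 - p) / ((1 + l) ^ 2 * (l + t))) +
            (l ^ 2)⁻¹ * (l⁻¹ ^ p / ((1 + l⁻¹) ^ 2 * (l⁻¹ + t)) +
              l⁻¹ ^ (1 - p) / ((1 + l⁻¹) ^ 2 * (l⁻¹ + t)))))
        (fun l => 2 * Real.sin (Real.pi * p) / (Real.pi * p * (1 - p)) *
          ((l ^ p + l ^ (1 - p)) / (1 + l) ^ 3) * extremeMC l t 1) (Ioo 0 1) := by
      intro l hl
      have hl0 := hl.1
      have h2 : l ^ (1 - p) = l / l ^ p := by rw [Real.rpow_sub hl0, Real.rpow_one]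
      have h3 : 0 < l ^ p := by positivity
      have h4 : l⁻¹ + t = (1 + l * t) / l := by field_simp
      have h5 : 1 + l⁻¹ = (1 + l) / l := by
        field_simp
        ring
      simp only [extremeMC]
      rw [Real.inv_rpow hl0.le, Real.inv_rpow hl0.le, h2, h4, h5]
      field_simp
      ring
    refine ⟨(integrableOn_congr_fun heq measurableSet_Ioo).1 (hj.const_mul _), ?_⟩
    rw [← setIntegral_congr_fun measurableSet_Ioo heq, integral_const_mul, hw, hv]
    field_simp

lemma wydMC_one_half {x y : ℝ} (hx : 0 < x) (hy : 0 < y) :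
    wydMC (1 / 2) x y = wignerYanaseMC x y := by
  have hx' : √x ^ 2 = x := Real.sq_sqrt hx.le
  have hy' : √y ^ 2 = y := Real.sq_sqrt hy.le
  have hx0 : 0 < √x := Real.sqrt_pos.2 hx
  have hy0 : 0 < √y := Real.sqrt_pos.2 hy
  rw [wydMC, wignerYanaseMC]
  split_ifs with hxy
  · subst hxy
    nth_rewrite 1 [← hx']
    field_simp
    norm_num
  · have hne : √x - √y ≠ 0 := fun h => hxy (by rw [← hx', ← hy', sub_eq_zero.1 h])
    have h1 : x - y = (√x - √y) * (√x + √y) := by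
      rw [← sub_eq_zero]
      linear_combination hy' - hx'
    rw [show (1 : ℝ) - 1 / 2 = 1 / 2 by norm_num, ← Real.sqrt_eq_rpow, ← Real.sqrt_eq_rpow, h1]
    field_simp
    norm_num

lemma Represents.congr {μ : Measure ℝ} {c d : ℝ → ℝ → ℝ} (h : Represents μ c)
    (hcd : ∀ x y, 0 < x → 0 < y → c x y = d x y) : Represents μ d :=
  ⟨h.finite, h.support, fun x y hx hy => by rw [← hcd x y hx hy, h.eq_integral x y hx hy]⟩

lemma represents_wignerYanaseMC :
    Represents (densityMeasure fun l => 16 * l ^ (1 / 2 : ℝ) / (Real.pi * (1 + l) ^ 3))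
      wignerYanaseMC := by
  have h := (represents_wydMC (p := 1 / 2) (by norm_num) (by norm_num)).congr
    fun x y hx hy => wydMC_one_half hx hy
  convert h using 2
  funext l
  rw [show (1 : ℝ) - 1 / 2 = 1 / 2 by norm_num, show 1 / 2 * Real.pi = Real.pi / 2 by ring,
    Real.sin_pi_div_two]
  field_simp
  ring

/-! ### The increasing bridge -/

lemma represents_bridgeMC_zero : Represents (Measure.dirac 1) (bridgeMC 0) := by
  refine ⟨inferInstance, by simp, fun x y hx hy => ?_⟩
  rw [integral_dirac]
  simp only [bridgeMC, extremeMC, neg_zero, Real.rpow_zero, mul_zero, zero_sub, one_mul]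
  rw [Real.rpow_neg_one]
  field_simp
  ring

lemma represents_bridgeMC_one : Represents (Measure.dirac 0) (bridgeMC 1) := by
  refine ⟨inferInstance, by simp, fun x y hx hy => ?_⟩
  rw [integral_dirac]
  simp only [bridgeMC, extremeMC, mul_one, zero_mul, zero_add, add_zero]
  rw [show (2 : ℝ) - 1 = 1 by norm_num, Real.rpow_one, Real.rpow_neg_one, Real.rpow_neg_one]
  field_simp
  ring

lemma bridgeMC_one_one (γ : ℝ) : bridgeMC γ 1 1 = 1 := by
  norm_num [bridgeMC]

lemma bridgeMC_eq_inv_mul (γ : ℝ) {x y : ℝ} (hx : 0 < x) (hy : 0 < y) :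
    bridgeMC γ x y = y⁻¹ * bridgeMC γ (x / y) 1 := by
  have h1 : (x / y + 1) / 2 = (x + y) / 2 / y := by field_simp
  have h2 : y ^ (2 * γ - 1) = (y ^ γ) ^ 2 / y := by
    rw [Real.rpow_sub hy, Real.rpow_one, mul_comm, Real.rpow_mul hy.le, Real.rpow_two]
  have h3 : 0 < y ^ γ := by positivity
  rw [bridgeMC, bridgeMC, h1, Real.div_rpow hx.le hy.le, Real.div_rpow (by positivity) hy.le, h2,
    Real.one_rpow, Real.rpow_neg hy.le]
  field_simp

lemma image_one_sub_sq_div_Ioo : (fun l : ℝ => (1 - l) ^ 2 / (4 * l)) '' Ioo 0 1 = Ioi 0 := by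
  ext v
  constructor
  · rintro ⟨l, ⟨hl0, hl1⟩, rfl⟩
    have : 0 < 1 - l := sub_pos.2 hl1
    exact div_pos (pow_pos this 2) (mul_pos four_pos hl0)
  · intro hv
    have hv : 0 < v := hv
    -- The smaller root `l` of `(1 - l) ^ 2 = 4 * l * v`.
    have hr : √(v ^ 2 + v) ^ 2 = v ^ 2 + v := Real.sq_sqrt (by positivity)
    have h1 : v < √(v ^ 2 + v) := Real.lt_sqrt_of_sq_lt (by linarith)
    have h2 : √(v ^ 2 + v) < v + 1 / 2 := by
      rw [Real.sqrt_lt' (by positivity)]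
      nlinarith
    have h3 : 0 < 1 + 2 * v - 2 * √(v ^ 2 + v) := by linarith
    refine ⟨1 + 2 * v - 2 * √(v ^ 2 + v), ⟨h3, by linarith⟩, ?_⟩
    simp only
    rw [div_eq_iff (by positivity)]
    linear_combination 4 * hr

lemma injOn_one_sub_sq_div : InjOn (fun l : ℝ => (1 - l) ^ 2 / (4 * l)) (Ioo 0 1) := by
  rintro a ⟨ha0, ha1⟩ b ⟨hb0, hb1⟩ hab
  simp only at hab
  rw [div_eq_div_iff (by positivity) (by positivity)] at hab
  have h : (b - a) * (1 - a * b) = 0 := by linear_combination hab / 4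
  rcases mul_eq_zero.1 h with h | h
  · linarith
  · nlinarith

/-- The substitution `v = (1 - l) ^ 2 / (4 * l)` turns the representation of `bridgeMC γ t 1` into
the integral of `v ^ (γ - 1) / (v + (1 + t) ^ 2 / (4 * t))` over the positive half-axis. -/
lemma represents_bridgeMC {γ : ℝ} (hγ0 : 0 < γ) (hγ1 : γ < 1) :
    Represents (densityMeasure fun l =>
      2 * Real.sin (γ * Real.pi) / ((1 + l) * Real.pi) * l ^ (-γ) *
        ((1 - l) / 2) ^ (2 * γ - 1)) (bridgeMC γ) := by
  have hsin : 0 < Real.sin (Real.pi * γ) :=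
    Real.sin_pos_of_pos_of_lt_pi (by positivity) (by nlinarith [Real.pi_pos])
  rw [mul_comm γ]
  refine represents_densityMeasure (by fun_prop) (fun l hl => ?_)
    (fun x y hx hy => bridgeMC_eq_inv_mul γ hx hy) fun t ht => ?_
  · have := hl.1
    have : 0 < 1 - l := sub_pos.2 hl.2
    positivity
  · obtain ⟨hi, hv⟩ := integral_rpow_div_add hγ0 hγ1 (show 0 < (1 + t) ^ 2 / (4 * t) by positivity)
    have hderiv : ∀ l ∈ Ioo (0 : ℝ) 1, HasDerivWithinAt (fun l : ℝ => (1 - l) ^ 2 / (4 * l))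
        (-((1 - l) * (1 + l) / (4 * l ^ 2))) (Ioo 0 1) l := by
      intro l hl
      have hl0 := hl.1
      refine ((((hasDerivAt_id l).const_sub 1).pow 2).div ((hasDerivAt_id l).const_mul 4)
        (by simpa using hl0.ne')).congr_deriv ?_ |>.hasDerivWithinAt
      simp only [id, Pi.pow_apply]
      field_simp
      ring
    rw [← image_one_sub_sq_div_Ioo] at hi hv
    rw [integrableOn_image_iff_integrableOn_abs_deriv_smul measurableSet_Ioo hderiv
      injOn_one_sub_sq_div] at hi
    rw [integral_image_eq_integral_abs_deriv_smul measurableSet_Ioo hderiv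
      injOn_one_sub_sq_div] at hv
    have heq : EqOn (fun l : ℝ => Real.sin (Real.pi * γ) / Real.pi * ((t + 1) / (2 * t)) *
          (|-((1 - l) * (1 + l) / (4 * l ^ 2))| • (((1 - l) ^ 2 / (4 * l)) ^ (γ - 1) /
            ((1 - l) ^ 2 / (4 * l) + (1 + t) ^ 2 / (4 * t)))))
        (fun l => 2 * Real.sin (Real.pi * γ) / ((1 + l) * Real.pi) * l ^ (-γ) *
          ((1 - l) / 2) ^ (2 * γ - 1) * extremeMC l t 1) (Ioo 0 1) := by
      intro l hl
      have hl0 := hl.1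
      have hl1 : 0 < 1 - l := sub_pos.2 hl.2
      have h1 : (1 - l) ^ 2 / (4 * l) = ((1 - l) / 2) ^ 2 / l := by
        field_simp
        norm_num
      have h2 : (((1 - l) / 2) ^ 2 / l) ^ (γ - 1) =
          (((1 - l) / 2) ^ γ) ^ 2 * l / (l ^ γ * ((1 - l) / 2) ^ 2) := by
        rw [Real.rpow_sub_one (by positivity), Real.div_rpow (by positivity) hl0.le,
          ← Real.rpow_pow_comm (by positivity)]
        field_simp
      have h3 : ((1 - l) / 2) ^ (2 * γ - 1) = (((1 - l) / 2) ^ γ) ^ 2 / ((1 - l) / 2) := by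
        rw [Real.rpow_sub_one (by positivity), mul_comm 2, Real.rpow_mul (by positivity),
          Real.rpow_two]
      have h4 : ((1 - l) / 2) ^ 2 / l + (1 + t) ^ 2 / (4 * t) =
          (t + l) * (l * t + 1) / (4 * (l * t)) * 1 := by
        field_simp
        ring
      simp only [smul_eq_mul, extremeMC]
      rw [abs_neg, abs_of_pos (by positivity), h1, h2, h3, h4, Real.rpow_neg hl0.le]
      have h5 : 0 < l ^ γ := by positivity
      have h6 : 0 < ((1 - l) / 2) ^ γ := by positivity
      generalize l ^ γ = r at *
      generalize ((1 - l) / 2) ^ γ = s at *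
      field_simp
      ring
    refine ⟨(integrableOn_congr_fun heq measurableSet_Ioo).1 (Integrable.const_mul hi _), ?_⟩
    rw [← setIntegral_congr_fun measurableSet_Ioo heq, integral_const_mul, hv]
    have h1 : (1 + t) ^ 2 / (4 * t) = ((t + 1) / 2) ^ 2 / t := by
      field_simp
      ring
    have h2 : (((t + 1) / 2) ^ 2 / t) ^ (γ - 1) =
        (((t + 1) / 2) ^ γ) ^ 2 * t / (t ^ γ * ((t + 1) / 2) ^ 2) := by
      rw [Real.rpow_sub_one (by positivity), Real.div_rpow (by positivity) ht.le,
        ← Real.rpow_pow_comm (by positivity)]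
      field_simp
    have h3 : ((t + 1) / 2) ^ (2 * γ - 1) = (((t + 1) / 2) ^ γ) ^ 2 / ((t + 1) / 2) := by
      rw [Real.rpow_sub_one (by positivity), mul_comm 2, Real.rpow_mul (by positivity),
        Real.rpow_two]
    rw [bridgeMC, h1, h2, h3, Real.rpow_neg ht.le, Real.one_rpow]
    field_simp

/-! ### The canonical representations -/

theorem mainTheorem9 :
    (∀ p : ℝ, 0 < p → p < 1 →
      IsNormalizedMorozovaChentsov (wydMC p) ∧
      IsRepresentingMeasure
        (densityMeasure fun l =>
          2 * Real.sin (p * Real.pi) / (Real.pi * p * (1 - p)) *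
            ((l ^ p + l ^ (1 - p)) / (1 + l) ^ 3))
        (wydMC p)) ∧
    ((∀ x y : ℝ, 0 < x → 0 < y → wydMC (1 / 2) x y = wignerYanaseMC x y) ∧
      IsNormalizedMorozovaChentsov wignerYanaseMC ∧
      IsRepresentingMeasure
        (densityMeasure fun l => 16 * l ^ (1 / 2 : ℝ) / (Real.pi * (1 + l) ^ 3))
        wignerYanaseMC) ∧
    (IsNormalizedMorozovaChentsov kuboMC ∧
      IsRepresentingMeasure (densityMeasure fun l => 2 / (1 + l) ^ 2) kuboMC) ∧
    ((∀ γ : ℝ, 0 ≤ γ → γ ≤ 1 → IsNormalizedMorozovaChentsov (bridgeMC γ)) ∧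
      IsRepresentingMeasure (Measure.dirac 1) (bridgeMC 0) ∧
      (∀ γ : ℝ, 0 < γ → γ < 1 →
        IsRepresentingMeasure
          (densityMeasure fun l =>
            2 * Real.sin (γ * Real.pi) / ((1 + l) * Real.pi) * l ^ (-γ) *
              ((1 - l) / 2) ^ (2 * γ - 1))
          (bridgeMC γ)) ∧
      IsRepresentingMeasure (Measure.dirac 0) (bridgeMC 1)) := by

  have hbridge : ∀ γ : ℝ, 0 ≤ γ → γ ≤ 1 → ∃ μ, Represents μ (bridgeMC γ) := by
    intro γ h0 h1
    rcases h0.eq_or_lt with rfl | h0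
    · exact ⟨_, represents_bridgeMC_zero⟩
    rcases h1.eq_or_lt with rfl | h1
    · exact ⟨_, represents_bridgeMC_one⟩
    · exact ⟨_, represents_bridgeMC h0 h1⟩
  refine ⟨fun p hp0 hp1 => ?_, ⟨fun x y hx hy => wydMC_one_half hx hy, ?_, ?_⟩, ⟨?_, ?_⟩,
    fun γ h0 h1 => ?_, ?_, fun γ h0 h1 => ?_, ?_⟩
  · exact ⟨(represents_wydMC hp0 hp1).isNormalizedMorozovaChentsov (by simp [wydMC]),
      (represents_wydMC hp0 hp1).isRepresentingMeasure⟩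
  · exact represents_wignerYanaseMC.isNormalizedMorozovaChentsov (by norm_num [wignerYanaseMC])
  · exact represents_wignerYanaseMC.isRepresentingMeasure
  · exact represents_kuboMC.isNormalizedMorozovaChentsov (by simp [kuboMC])
  · exact represents_kuboMC.isRepresentingMeasure
  · obtain ⟨μ, hμ⟩ := hbridge γ h0 h1
    exact hμ.isNormalizedMorozovaChentsov (bridgeMC_one_one γ)
  · exact represents_bridgeMC_zero.isRepresentingMeasure
  · exact (represents_bridgeMC h0 h1).isRepresentingMeasure
  · exact represents_bridgeMC_one.isRepresentingMeasure
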